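/- Let $\mathbb{F}_q$ be a finite field with $q$ elements and characteristic $p$, let $n\ge 1$, and write $n=p^s n_0$ with $s \ge 0$ and $\gcd(n_0,p)=1$. Let $d$ be the least positive integer such that $q^d\equiv 1 \pmod{n_0}$. For each $r\ge 1$ let $v_r$ be the number of distinct monic irreducible factors of degree $r$ of $x^n-1$ over $\mathbb{F}_q$. For $\alpha\in\mathbb{F}_{q^n}$ put $g_\alpha(x)=\sum_{i=0}^{n-1}\alpha^{q^i}x^{n-1-i}\in\mathbb{F}_{q^n}[x]$, and call $\alpha$ a $k$-normal element of $\mathbb{F}_{q^n}$ over $\mathbb{F}_q$ if $\gcd(x^n-1,g_\alpha(x))$, computed over $\mathbb{F}_{q^n}$, has degree $k$; here $0\le k\le n$, and $k=n$ occurs for $\alpha=0$ only. Then the number $N_3$ of $3$-normal elements of $\mathbb{F}_{q^n}$ over $\mathbb{F}_q$ is $$ N_3=\begin{cases} \left(v_1+\frac16 v_1(v_1-1)(v_1+4)+v_1v_2+v_3\right)q^{n-n_0-3}\displaystyle\prod_{r\mid d}(q^r-1)^{v_r} & \text{if } p^s>3,\\[2mm] \left(\frac{q}{q-1}v_1+\frac16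 v_1(v_1-1)(v_1+4)+v_1v_2+v_3\right)q^{n-n_0-3}\displaystyle\prod_{r\mid d}(q^r-1)^{v_r} & \text{if } p^s=3,\\[2mm] \left(\left(\frac{q}{q-1}+\frac{v_1-2}{6}\right)v_1(v_1-1)+v_1v_2+v_3\right)q^{n-n_0-3}\displaystyle\prod_{r\mid d}(q^r-1)^{v_r} & \text{if } p^s=2,\\[2mm] \left(\frac{v_1(v_1-1)(v_1-2)}{6(q-1)^3}+\frac{v_1v_2}{(q-1)(q^2-1)}+\frac{v_3}{q^3-1}\right)\displaystyle\prod_{r\mid d}(q^r-1)^{v_r} & \text{if } n=n_0. \end{cases} $$ -/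

import Mathlib

open Polynomial

/-- For `α` in a finite extension `K` of a finite field `F` with `q` elements, of degree `n`,
the polynomial `g_α(x) = ∑_{i=0}^{n-1} α^{q^i} x^{n-1-i}` in `K[x]`. -/
noncomputable def conjugatePoly (F : Type*) {K : Type*} [Field F] [Field K] [Algebra F K]
    (α : K) : K[X] :=
  ∑ i ∈ Finset.range (Module.finrank F K),
    C (α ^ Nat.card F ^ i) * X ^ (Module.finrank F K - 1 - i)

open Classical in
/-- `α` is `k`-normal over `F`: the greatest common divisor of `x^n - 1` and `g_α(x)` over `K`
has degree `k`, where `n = [K : F]`. (The element `0` is the only one for which `k = n`.) -/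
def IsKNormal (F : Type*) {K : Type*} [Field F] [Field K] [Algebra F K] (k : ℕ) (α : K) : Prop :=
  (EuclideanDomain.gcd ((X : K[X]) ^ Module.finrank F K - 1) (conjugatePoly F α)).degree = k

/-- The number `N_k` of `k`-normal elements of `K` over `F`. -/
noncomputable def numKNormal (F K : Type*) [Field F] [Field K] [Algebra F K] (k : ℕ) : ℕ :=
  Set.ncard {α : K | IsKNormal F k α}

/-- The number `v_r` of distinct monic irreducible factors of degree `r` of `x^n - 1` over `F`. -/
noncomputable def numIrredFactors (F : Type*) [Field F] (n r : ℕ) : ℕ :=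
  Set.ncard {g : F[X] | g.Monic ∧ Irreducible g ∧ g ∣ X ^ n - 1 ∧ g.natDegree = r}

section gcdDegree

open Classical in
/-- The degree of the greatest common divisor of two polynomials over a field. -/
noncomputable def gcdDegree {F : Type*} [Field F] (f g : F[X]) : ℕ :=
  (EuclideanDomain.gcd f g).natDegree

variable {F : Type*} [Field F]

theorem Polynomial.natDegree_eq_of_dvd_dvd {f g : F[X]} (h₁ : f ∣ g) (h₂ : g ∣ f) :
    f.natDegree = g.natDegree :=
  natDegree_eq_of_degree_eq (degree_eq_degree_of_associated (associated_of_dvd_dvd h₁ h₂))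

theorem gcdDegree_congr {f g f' g' : F[X]} (h : ∀ d, (d ∣ f ∧ d ∣ g) ↔ (d ∣ f' ∧ d ∣ g')) :
    gcdDegree f g = gcdDegree f' g' := by
  classical
  have h₁ := (h (EuclideanDomain.gcd f g)).1
    ⟨EuclideanDomain.gcd_dvd_left .., EuclideanDomain.gcd_dvd_right ..⟩
  have h₂ := (h (EuclideanDomain.gcd f' g')).2
    ⟨EuclideanDomain.gcd_dvd_left .., EuclideanDomain.gcd_dvd_right ..⟩
  unfold gcdDegree
  convert natDegree_eq_of_dvd_dvd (EuclideanDomain.dvd_gcd h₁.1 h₁.2)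
    (EuclideanDomain.dvd_gcd h₂.1 h₂.2)

theorem gcdDegree_comm (f g : F[X]) : gcdDegree f g = gcdDegree g f :=
  gcdDegree_congr fun _ => and_comm

theorem gcdDegree_modByMonic (f g : F[X]) : gcdDegree (f %ₘ g) g = gcdDegree f g := by
  refine gcdDegree_congr fun d => and_congr_left fun hd => ?_
  nth_rw 2 [← modByMonic_add_div f g]
  exact (dvd_add_left (hd.mul_right _)).symm

theorem gcdDegree_of_isCoprime {f g : F[X]} (h : IsCoprime f g) : gcdDegree f g = 0 := by
  classical
  have := (EuclideanDomain.gcd_isUnit_iff).2 h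
  unfold gcdDegree
  convert natDegree_eq_zero_of_isUnit this

theorem gcdDegree_mul_right {f g h : F[X]} (hg : g ≠ 0) (hh : h ≠ 0) (hc : IsCoprime g h) :
    gcdDegree f (g * h) = gcdDegree f g + gcdDegree f h := by
  classical
  have hg' : EuclideanDomain.gcd f g ≠ 0 := fun h0 => hg (EuclideanDomain.gcd_eq_zero_iff.1 h0).2
  have hh' : EuclideanDomain.gcd f h ≠ 0 := fun h0 => hh (EuclideanDomain.gcd_eq_zero_iff.1 h0).2
  have key : (EuclideanDomain.gcd f (g * h)).natDegree =
      (EuclideanDomain.gcd f g * EuclideanDomain.gcd f h).natDegree := by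
    apply natDegree_eq_of_dvd_dvd
    · rw [EuclideanDomain.gcd_eq_gcd_ab f g, EuclideanDomain.gcd_eq_gcd_ab f h]
      generalize EuclideanDomain.gcdA f g = a
      generalize EuclideanDomain.gcdB f g = b
      generalize EuclideanDomain.gcdA f h = a'
      generalize EuclideanDomain.gcdB f h = b'
      have e₁ := EuclideanDomain.gcd_dvd_left f (g * h)
      have e₂ := EuclideanDomain.gcd_dvd_right f (g * h)
      generalize EuclideanDomain.gcd f (g * h) = c at e₁ e₂ ⊢
      have : (f * a + g * b) * (f * a' + h * b') =
          f * (a * (f * a' + h * b') + g * b * a') + g * h * (b * b') := by ring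
      rw [this]
      exact dvd_add (e₁.mul_right _) (e₂.mul_right _)
    · have hgf := EuclideanDomain.gcd_dvd_left f g
      have hgg := EuclideanDomain.gcd_dvd_right f g
      have hhf := EuclideanDomain.gcd_dvd_left f h
      have hhh := EuclideanDomain.gcd_dvd_right f h
      refine EuclideanDomain.dvd_gcd (IsCoprime.mul_dvd ?_ hgf hhf) (mul_dvd_mul hgg hhh)
      exact (hc.of_isCoprime_of_dvd_left hgg).of_isCoprime_of_dvd_right hhh
  rw [natDegree_mul hg' hh'] at key
  unfold gcdDegree
  convert key

theorem gcdDegree_mul_mul {f g h : F[X]} (hf : f ≠ 0) (hh : h ≠ 0) :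
    gcdDegree (f * g) (f * h) = f.natDegree + gcdDegree g h := by
  classical
  have hh' : EuclideanDomain.gcd g h ≠ 0 := fun h0 => hh (EuclideanDomain.gcd_eq_zero_iff.1 h0).2
  have key : (EuclideanDomain.gcd (f * g) (f * h)).natDegree =
      (f * EuclideanDomain.gcd g h).natDegree := by
    apply natDegree_eq_of_dvd_dvd
    · rw [EuclideanDomain.gcd_eq_gcd_ab g h, mul_add, ← mul_assoc, ← mul_assoc]
      exact dvd_add ((EuclideanDomain.gcd_dvd_left _ _).mul_right _)
        ((EuclideanDomain.gcd_dvd_right _ _).mul_right _)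
    · exact EuclideanDomain.dvd_gcd (mul_dvd_mul_left _ (EuclideanDomain.gcd_dvd_left ..))
        (mul_dvd_mul_left _ (EuclideanDomain.gcd_dvd_right ..))
  rw [natDegree_mul hf hh'] at key
  unfold gcdDegree
  convert key

theorem modByMonic_mem_degreeLT {M : F[X]} (hM : M.Monic) (f : F[X]) :
    f %ₘ M ∈ degreeLT F M.natDegree := by
  rw [mem_degreeLT, ← degree_eq_natDegree hM.ne_zero]
  exact degree_modByMonic_lt f hM

theorem eq_zero_of_mem_degreeLT_of_dvd {M f : F[X]} (hM : M ≠ 0)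
    (hf : f ∈ degreeLT F M.natDegree) (h : M ∣ f) : f = 0 := by
  rw [mem_degreeLT, ← degree_eq_natDegree hM] at hf
  exact eq_zero_of_dvd_of_degree_lt h hf

end gcdDegree

section generating

variable {F : Type*} [Field F] [Finite F]

theorem card_degreeLT (F : Type*) [Field F] (n : ℕ) :
    Nat.card (degreeLT F n) = Nat.card F ^ n := by
  rw [Nat.card_congr (degreeLTEquiv F n).toEquiv, Nat.card_fun, Nat.card_fin]

instance finite_degreeLT (n : ℕ) : Finite (degreeLT F n) :=
  Finite.of_equiv _ (degreeLTEquiv F n).toEquiv.symm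

noncomputable instance fintypeDegreeLT (n : ℕ) : Fintype (degreeLT F n) := Fintype.ofFinite _

/-- The generating polynomial of the degrees of the greatest common divisors with `M` of the
polynomials of degree less than that of `M`. -/
noncomputable def gcdDegreePoly (M : F[X]) : ℚ[X] :=
  ∑ f : degreeLT F M.natDegree, X ^ gcdDegree (f : F[X]) M

theorem coeff_gcdDegreePoly (M : F[X]) (k : ℕ) :
    (gcdDegreePoly M).coeff k =
      Nat.card {f : degreeLT F M.natDegree // gcdDegree (f : F[X]) M = k} := by
  classical
  simp only [gcdDegreePoly, finsetSum_coeff, coeff_X_pow]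
  rw [Finset.sum_boole, Nat.card_eq_fintype_card, Fintype.card_subtype]
  simp only [eq_comm]

theorem gcdDegreePoly_mul {M N : F[X]} (hM : M.Monic) (hN : N.Monic) (h : IsCoprime M N) :
    gcdDegreePoly (M * N) = gcdDegreePoly M * gcdDegreePoly N := by
  let e : degreeLT F (M * N).natDegree → degreeLT F M.natDegree × degreeLT F N.natDegree :=
    fun f => (⟨_, modByMonic_mem_degreeLT hM f⟩, ⟨_, modByMonic_mem_degreeLT hN f⟩)
  have he : Function.Bijective e := by
    apply Function.Injective.bijective_of_nat_card_le
    · intro f g hfg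
      simp only [e, Prod.mk.injEq, Subtype.mk.injEq] at hfg
      have key (L : F[X]) (hL : L.Monic) (hfg : (f : F[X]) %ₘ L = (g : F[X]) %ₘ L) :
          L ∣ (f - g : F[X]) := by
        rw [← modByMonic_eq_zero_iff_dvd hL, sub_modByMonic, hfg, sub_self]
      have := eq_zero_of_mem_degreeLT_of_dvd (hM.mul hN).ne_zero (sub_mem f.2 g.2)
        (h.mul_dvd (key M hM hfg.1) (key N hN hfg.2))
      exact Subtype.ext (sub_eq_zero.1 this)
    · rw [Nat.card_prod, card_degreeLT, card_degreeLT, card_degreeLT, ← pow_add,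
        hM.natDegree_mul hN]
  rw [gcdDegreePoly, gcdDegreePoly, gcdDegreePoly, Finset.sum_mul_sum,
    ← Fintype.sum_prod_type']
  refine Fintype.sum_bijective e he _ _ fun f => ?_
  rw [← pow_add, gcdDegree_modByMonic, gcdDegree_modByMonic,
    gcdDegree_mul_right hM.ne_zero hN.ne_zero h]

theorem gcdDegreePoly_one : gcdDegreePoly (1 : F[X]) = 1 := by
  have : ∀ f : F[X], gcdDegree f 1 = 0 := fun f => gcdDegree_of_isCoprime isCoprime_one_right
  simp only [gcdDegreePoly, this, pow_zero, Finset.sum_const, Finset.card_univ, nsmul_eq_mul,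
    mul_one]
  rw [← Nat.card_eq_fintype_card, card_degreeLT]
  simp

theorem gcdDegreePoly_prod {ι : Type*} (s : Finset ι) (f : ι → F[X]) (hf : ∀ i ∈ s, (f i).Monic)
    (hc : (s : Set ι).Pairwise fun i j => IsCoprime (f i) (f j)) :
    gcdDegreePoly (∏ i ∈ s, f i) = ∏ i ∈ s, gcdDegreePoly (f i) := by
  classical
  induction s using Finset.induction_on with
  | empty => simp [gcdDegreePoly_one]
  | insert a s ha ih =>
    rw [Finset.prod_insert ha, Finset.prod_insert ha, gcdDegreePoly_mul, ih]
    · exact fun i hi => hf i (Finset.mem_insert_of_mem hi)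
    · exact hc.mono (by simp)
    · exact hf a (Finset.mem_insert_self ..)
    · exact monic_prod_of_monic _ _ fun i hi => hf i (Finset.mem_insert_of_mem hi)
    · refine IsCoprime.prod_right fun i hi => hc (by simp) (by simp [hi]) ?_
      rintro rfl; exact ha hi

theorem gcdDegreePoly_irreducible_pow_succ {P : F[X]} (hP : P.Monic) (hirr : Irreducible P)
    (e : ℕ) :
    gcdDegreePoly (P ^ (e + 1)) =
      C (((Nat.card F : ℚ) ^ P.natDegree - 1) * ((Nat.card F : ℚ) ^ P.natDegree) ^ e) +
        X ^ P.natDegree * gcdDegreePoly (P ^ e) := by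
  classical
  set m := (P ^ e).natDegree with hm
  have hdeg : (P ^ (e + 1)).natDegree = P.natDegree + m := by
    rw [pow_succ', hP.natDegree_mul (hP.pow e)]
  have hmul : ∀ g : F[X], P * g ∈ degreeLT F (P ^ (e + 1)).natDegree ↔ g ∈ degreeLT F m := by
    intro g
    rw [mem_degreeLT, mem_degreeLT, hdeg, degree_mul, degree_eq_natDegree hP.ne_zero,
      Nat.cast_add]
    exact WithBot.add_lt_add_iff_left (WithBot.natCast_ne_bot _)
  let φ : degreeLT F m → degreeLT F (P ^ (e + 1)).natDegree := fun g => ⟨P * g, (hmul g).2 g.2⟩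
  have hφ : Function.Injective φ := by
    intro g g' h
    exact Subtype.ext (mul_left_cancel₀ hP.ne_zero (congrArg Subtype.val h))
  have himg : Finset.univ.filter (fun f : degreeLT F (P ^ (e + 1)).natDegree => P ∣ (f : F[X])) =
      Finset.univ.image φ := by
    ext f
    simp only [Finset.mem_filter, Finset.mem_univ, true_and, Finset.mem_image]
    constructor
    · rintro ⟨g, hg⟩
      exact ⟨⟨g, (hmul g).1 (hg ▸ f.2)⟩, Subtype.ext hg.symm⟩
    · rintro ⟨g, rfl⟩
      exact dvd_mul_right ..
  have hdvd : ∑ f ∈ Finset.univ.filter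
        (fun f : degreeLT F (P ^ (e + 1)).natDegree => P ∣ (f : F[X])),
      (X : ℚ[X]) ^ gcdDegree (f : F[X]) (P ^ (e + 1)) =
        X ^ P.natDegree * gcdDegreePoly (P ^ e) := by
    rw [himg, Finset.sum_image hφ.injOn, gcdDegreePoly, Finset.mul_sum]
    refine Finset.sum_congr rfl fun g _ => ?_
    change X ^ gcdDegree (P * (g : F[X])) (P ^ (e + 1)) = _
    rw [← pow_add, ← gcdDegree_mul_mul hP.ne_zero (hP.pow e).ne_zero, pow_succ']
  have hndvd : ∑ f ∈ Finset.univ.filter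
        (fun f : degreeLT F (P ^ (e + 1)).natDegree => ¬ P ∣ (f : F[X])),
      (X : ℚ[X]) ^ gcdDegree (f : F[X]) (P ^ (e + 1)) =
        C (((Nat.card F : ℚ) ^ P.natDegree - 1) * ((Nat.card F : ℚ) ^ P.natDegree) ^ e) := by
    have h1 : ∀ f ∈ Finset.univ.filter
        (fun f : degreeLT F (P ^ (e + 1)).natDegree => ¬ P ∣ (f : F[X])),
        (X : ℚ[X]) ^ gcdDegree (f : F[X]) (P ^ (e + 1)) = 1 := by
      intro f hf
      rw [gcdDegree_of_isCoprime, pow_zero]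
      exact ((hirr.coprime_iff_not_dvd).2 (Finset.mem_filter.1 hf).2).symm.pow_right
    rw [Finset.sum_congr rfl h1, Finset.sum_const, nsmul_eq_mul, mul_one]
    have hcard := Finset.card_filter_add_card_filter_not (s := Finset.univ)
      (fun f : degreeLT F (P ^ (e + 1)).natDegree => P ∣ (f : F[X]))
    rw [himg, Finset.card_image_of_injective _ hφ, Finset.card_univ, Finset.card_univ,
      ← Nat.card_eq_fintype_card, ← Nat.card_eq_fintype_card, card_degreeLT, card_degreeLT,
      hdeg] at hcard
    have hq : ((Nat.card F : ℚ) ^ P.natDegree) ^ e = (Nat.card F : ℚ) ^ m := by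
      rw [hm, hP.natDegree_pow, ← pow_mul, mul_comm]
    rw [hq, ← C_eq_natCast]
    congr 1
    have hcard' := congrArg (Nat.cast : ℕ → ℚ) hcard
    rw [Nat.cast_add] at hcard'
    refine Eq.trans ?_ ((eq_sub_of_add_eq' hcard').trans ?_)
    · congr!
    · push_cast
      ring
  rw [gcdDegreePoly, ← Finset.sum_filter_add_sum_filter_not Finset.univ
    (fun f : degreeLT F (P ^ (e + 1)).natDegree => P ∣ (f : F[X])), hdvd, hndvd, add_comm]

end generating

section conjugates

variable {F K : Type*} [Field F] [Finite F] [Field K] [Algebra F K]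

variable (F K) in
/-- The Frobenius `a ↦ a ^ q` of an algebra over a field with `q` elements, as a linear map. -/
noncomputable def frobeniusEnd : Module.End F K :=
  letI := Fintype.ofFinite F
  (FiniteField.frobeniusAlgHom F K).toLinearMap

theorem frobeniusEnd_apply (a : K) : frobeniusEnd F K a = a ^ Nat.card F := by
  let _ := Fintype.ofFinite F
  rw [Nat.card_eq_fintype_card]
  rfl

theorem frobeniusEnd_pow_apply (i : ℕ) (a : K) :
    (frobeniusEnd F K ^ i) a = a ^ Nat.card F ^ i := by
  induction i with
  | zero => simp
  | succ i ih => rw [pow_succ', Module.End.mul_apply, ih, frobeniusEnd_apply, ← pow_mul, pow_succ]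

theorem conjugatePoly_add (a b : K) :
    conjugatePoly F (a + b) = conjugatePoly F a + conjugatePoly F b := by
  simp only [conjugatePoly, ← frobeniusEnd_pow_apply, map_add, add_mul, Finset.sum_add_distrib]

theorem conjugatePoly_smul (c : F) (a : K) :
    conjugatePoly F (c • a) = C (algebraMap F K c) * conjugatePoly F a := by
  simp only [conjugatePoly, ← frobeniusEnd_pow_apply, map_smul, Finset.mul_sum]
  simp only [Algebra.smul_def, C_mul, mul_assoc]

section
variable [Finite K]

theorem pow_card_pow_finrank (a : K) : a ^ Nat.card F ^ Module.finrank F K = a := by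
  let _ := Fintype.ofFinite F
  let _ := Fintype.ofFinite K
  rw [← Module.natCard_eq_pow_finrank (K := F) (V := K), Nat.card_eq_fintype_card,
    FiniteField.pow_card]

theorem dvd_conjugatePoly_frobeniusEnd_sub (a : K) :
    (X ^ Module.finrank F K - 1 : K[X]) ∣
      conjugatePoly F (frobeniusEnd F K a) - X * conjugatePoly F a := by
  set n := Module.finrank F K with hn
  let t : ℕ → K[X] := fun i => C (a ^ Nat.card F ^ i) * X ^ (n - i)
  have h₁ : conjugatePoly F (frobeniusEnd F K a) = ∑ i ∈ Finset.range n, t (i + 1) := by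
    rw [conjugatePoly]
    refine Finset.sum_congr rfl fun i _ => ?_
    rw [frobeniusEnd_apply, ← pow_mul, ← pow_succ', ← hn, Nat.sub_sub, add_comm 1 i]
  have h₂ : X * conjugatePoly F a = ∑ i ∈ Finset.range n, t i := by
    rw [conjugatePoly, Finset.mul_sum]
    refine Finset.sum_congr rfl fun i hi => ?_
    have := Finset.mem_range.1 hi
    rw [mul_left_comm, ← pow_succ', ← hn, show n - 1 - i + 1 = n - i by omega]
  rw [h₁, h₂, ← Finset.sum_sub_distrib, Finset.sum_range_sub]
  have : t n - t 0 = (X ^ n - 1) * (- C a) := by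
    simp only [t, hn, pow_card_pow_finrank]
    simp
    ring
  rw [this]
  exact dvd_mul_right ..

theorem dvd_conjugatePoly_aeval_sub (f : F[X]) (a : K) :
    (X ^ Module.finrank F K - 1 : K[X]) ∣
      conjugatePoly F (aeval (frobeniusEnd F K) f a) -
        f.map (algebraMap F K) * conjugatePoly F a := by
  induction f using Polynomial.induction_on with
  | C c =>
    simp [conjugatePoly_smul, Module.algebraMap_end_apply]
  | add f g hf hg =>
    rw [map_add, LinearMap.add_apply, conjugatePoly_add, Polynomial.map_add, add_mul,
      add_sub_add_comm]
    exact dvd_add hf hg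
  | monomial k c ih =>
    have h : aeval (frobeniusEnd F K) (C c * X ^ (k + 1)) a =
        frobeniusEnd F K (aeval (frobeniusEnd F K) (C c * X ^ k) a) := by
      rw [pow_succ, ← mul_assoc, mul_comm, map_mul, aeval_X, Module.End.mul_apply]
    rw [h, pow_succ, ← mul_assoc, Polynomial.map_mul, map_X]
    set b := aeval (frobeniusEnd F K) (C c * X ^ k) a
    have : conjugatePoly F (frobeniusEnd F K b) -
        (C c * X ^ k).map (algebraMap F K) * X * conjugatePoly F a =
        (conjugatePoly F (frobeniusEnd F K b) - X * conjugatePoly F b) + X * (conjugatePoly F b -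
          (C c * X ^ k).map (algebraMap F K) * conjugatePoly F a) := by ring
    rw [this]
    exact dvd_add (dvd_conjugatePoly_frobeniusEnd_sub b) (ih.mul_left X)

variable (F K) in
theorem exists_bijective_aeval_frobeniusEnd :
    ∃ b : K, Function.Bijective fun f : degreeLT F (Module.finrank F K) =>
      aeval (frobeniusEnd F K) (f : F[X]) b := by
  let _ := Fintype.ofFinite F
  have : FiniteDimensional F K := Module.Finite.of_finite
  obtain ⟨b, hb⟩ := exists_linearIndependent_algEquiv_apply F K
  refine ⟨b, Function.Injective.bijective_of_nat_card_le ?_ ?_⟩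
  · have hli : LinearIndependent F
        fun i : Fin (Module.finrank F K) => (frobeniusEnd F K ^ (i : ℕ)) b := by
      convert hb.comp _ (FiniteField.bijective_frobeniusAlgEquivOfAlgebraic_pow F K).injective
        using 2 with i
      rw [frobeniusEnd_pow_apply, Function.comp_apply, AlgEquiv.coe_pow,
        FiniteField.coe_frobeniusAlgEquivOfAlgebraic_iterate, Nat.card_eq_fintype_card]
    intro f g hfg
    have hn : 0 < Module.finrank F K := Module.finrank_pos
    have h0 : aeval (frobeniusEnd F K) (f - g : F[X]) b = 0 := by
      rw [map_sub, LinearMap.sub_apply, sub_eq_zero]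
      exact hfg
    have hdeg := mem_degreeLT.1 (sub_mem f.2 g.2)
    have hnat : (f - g : F[X]).natDegree < Module.finrank F K := by
      rcases eq_or_ne (f - g : F[X]) 0 with h | h
      · rwa [h, natDegree_zero]
      · exact (natDegree_lt_iff_degree_lt h).2 hdeg
    rw [aeval_eq_sum_range' hnat, LinearMap.sum_apply, Finset.sum_range] at h0
    have h1 := Fintype.linearIndependent_iff.1 hli _ h0
    refine Subtype.ext (sub_eq_zero.1 (Polynomial.ext fun i => ?_))
    by_cases hi : i < Module.finrank F K
    · simpa using h1 ⟨i, hi⟩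
    · exact coeff_eq_zero_of_natDegree_lt (by omega)
  · rw [card_degreeLT, Module.natCard_eq_pow_finrank (K := F) (V := K)]

theorem span_conjugates_eq_top :
    Submodule.span K (Set.range fun (a : K) (i : Fin (Module.finrank F K)) =>
      a ^ Nat.card F ^ (i : ℕ)) = ⊤ := by
  let _ := Fintype.ofFinite F
  have hinj : Function.Injective fun i : Fin (Module.finrank F K) =>
      ((FiniteField.frobeniusAlgHom F K ^ (i : ℕ) : K →ₐ[F] K) : K →* K) := by
    intro i j hij
    refine (FiniteField.bijective_frobeniusAlgHom_pow F K).injective ?_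
    exact AlgHom.ext fun a => DFunLike.congr_fun hij a
  have hli := (linearIndependent_monoidHom K K).comp _ hinj
  refine (span_flip_eq_top_iff_linearIndependent (F := K)
    (f := fun (i : Fin (Module.finrank F K)) (a : K) => a ^ Nat.card F ^ (i : ℕ))).2 ?_
  have heq : (fun (i : Fin (Module.finrank F K)) (a : K) => a ^ Nat.card F ^ (i : ℕ)) =
      (fun f : K →* K => (f : K → K)) ∘ fun i : Fin (Module.finrank F K) =>
        ((FiniteField.frobeniusAlgHom F K ^ (i : ℕ) : K →ₐ[F] K) : K →* K) := by
    funext i a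
    simp [FiniteField.coe_frobeniusAlgHom]
  rw [heq]
  exact hli

theorem isCoprime_X_pow_sub_one_conjugatePoly {b : K}
    (hb : Function.Surjective fun f : degreeLT F (Module.finrank F K) =>
      aeval (frobeniusEnd F K) (f : F[X]) b) :
    IsCoprime (X ^ Module.finrank F K - 1 : K[X]) (conjugatePoly F b) := by
  have : FiniteDimensional F K := Module.Finite.of_finite
  have hn : 0 < Module.finrank F K := Module.finrank_pos
  let I : Ideal K[X] := Ideal.span {X ^ Module.finrank F K - 1, conjugatePoly F b}
  have hI (a : K) : conjugatePoly F a ∈ I := by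
    obtain ⟨f, rfl⟩ := hb a
    have h₁ := dvd_conjugatePoly_aeval_sub (f : F[X]) b
    rw [← sub_add_cancel (conjugatePoly F _) ((f : F[X]).map (algebraMap F K) * conjugatePoly F b)]
    exact add_mem (Ideal.mem_of_dvd _ h₁ (Ideal.subset_span (by simp)))
      (Ideal.mul_mem_left _ _ (Ideal.subset_span (by simp)))
  let T : (Fin (Module.finrank F K) → K) →ₗ[K] K[X] :=
    { toFun := fun w => ∑ i, C (w i) * X ^ (Module.finrank F K - 1 - i)
      map_add' := fun w w' => by simp [add_mul, Finset.sum_add_distrib]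
      map_smul' := fun c w => by simp [Finset.mul_sum, smul_eq_C_mul, mul_assoc] }
  have hT : ∀ w, T w ∈ I.restrictScalars K := by
    intro w
    have hw : w ∈ Submodule.span K (Set.range fun (a : K) (i : Fin (Module.finrank F K)) =>
      a ^ Nat.card F ^ (i : ℕ)) := span_conjugates_eq_top (F := F) (K := K) ▸ Submodule.mem_top
    refine (Submodule.span_le (p := (I.restrictScalars K).comap T)).2 ?_ hw
    rintro _ ⟨a, rfl⟩
    have : T (fun i => a ^ Nat.card F ^ (i : ℕ)) = conjugatePoly F a := by
      rw [conjugatePoly, Finset.sum_range]; rfl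
    rw [SetLike.mem_coe, Submodule.mem_comap, this]
    exact hI a
  have h1 : (1 : K[X]) ∈ I := by
    have := hT (Pi.single ⟨Module.finrank F K - 1, by omega⟩ 1)
    simpa [T, Pi.single_apply, apply_ite C] using this
  exact Ideal.mem_span_pair.1 h1

theorem isKNormal_aeval_iff {b : K}
    (hb : IsCoprime (X ^ Module.finrank F K - 1 : K[X]) (conjugatePoly F b)) (f : F[X]) (k : ℕ) :
    IsKNormal F k (aeval (frobeniusEnd F K) f b) ↔
      gcdDegree f (X ^ Module.finrank F K - 1) = k := by
  classical
  have hn : 0 < Module.finrank F K :=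
    have : FiniteDimensional F K := Module.Finite.of_finite
    Module.finrank_pos
  have hM : (X ^ Module.finrank F K - 1 : K[X]) ≠ 0 := X_pow_sub_C_ne_zero hn 1
  have h₁ : gcdDegree (X ^ Module.finrank F K - 1) (conjugatePoly F (aeval (frobeniusEnd F K) f b)) =
      gcdDegree (X ^ Module.finrank F K - 1) (f.map (algebraMap F K)) := by
    refine gcdDegree_congr fun d => and_congr_right fun hd => ?_
    rw [dvd_iff_dvd_of_dvd_sub (hd.trans (dvd_conjugatePoly_aeval_sub f b))]
    exact ⟨fun h => (hb.of_isCoprime_of_dvd_left hd).dvd_of_dvd_mul_right h,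
      fun h => h.mul_right _⟩
  have h₂ : gcdDegree (X ^ Module.finrank F K - 1) (f.map (algebraMap F K)) =
      gcdDegree f (X ^ Module.finrank F K - 1) := by
    have hmap : (X ^ Module.finrank F K - 1 : K[X]) =
        (X ^ Module.finrank F K - 1 : F[X]).map (algebraMap F K) := by simp
    rw [gcdDegree_comm, hmap]
    unfold gcdDegree
    rw [gcd_map, natDegree_map]
  rw [← h₂, ← h₁]
  refine (degree_eq_iff_natDegree_eq fun h0 => hM (EuclideanDomain.gcd_eq_zero_iff.1 h0).1).trans ?_
  unfold gcdDegree
  exact Iff.rfl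

theorem numKNormal_eq_coeff (k : ℕ) :
    (numKNormal F K k : ℚ) = (gcdDegreePoly (X ^ Module.finrank F K - 1 : F[X])).coeff k := by
  obtain ⟨b, hb⟩ := exists_bijective_aeval_frobeniusEnd F K
  have hc := isCoprime_X_pow_sub_one_conjugatePoly hb.surjective
  have hdeg : (X ^ Module.finrank F K - 1 : F[X]).natDegree = Module.finrank F K :=
    natDegree_X_pow_sub_C
  rw [coeff_gcdDegreePoly, numKNormal, ← Nat.card_coe_set_eq, hdeg, Nat.cast_inj]
  refine (Nat.card_congr ((Equiv.ofBijective _ hb).subtypeEquiv fun f => ?_)).symm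
  exact (isKNormal_aeval_iff hc f k).symm

end

end conjugates

section coefficients

theorem coeff_prod_of_coeff_eq {ι : Type*} (S : Finset ι) (deg : ι → ℕ)
    (hdeg : ∀ i ∈ S, 0 < deg i) (G : ι → ℚ[X]) (A : ℕ → ℚ) (a₁ a₂ a₃ b c : ℚ)
    (h₀ : ∀ i ∈ S, (G i).coeff 0 = A (deg i))
    (h₁ : ∀ i ∈ S, (G i).coeff 1 = A (deg i) * if deg i = 1 then a₁ else 0)
    (h₂ : ∀ i ∈ S, (G i).coeff 2 =
      A (deg i) * if deg i = 1 then a₂ else if deg i = 2 then b else 0)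
    (h₃ : ∀ i ∈ S, (G i).coeff 3 =
      A (deg i) * if deg i = 1 then a₃ else if deg i = 3 then c else 0)
    (v : ℕ → ℚ) (hv : ∀ r, v r = (S.filter fun i => deg i = r).card) :
    (∏ i ∈ S, G i).coeff 0 = ∏ i ∈ S, A (deg i) ∧
    (∏ i ∈ S, G i).coeff 1 = (∏ i ∈ S, A (deg i)) * (a₁ * v 1) ∧
    (∏ i ∈ S, G i).coeff 2 =
      (∏ i ∈ S, A (deg i)) * (a₂ * v 1 + a₁ ^ 2 * (v 1 * (v 1 - 1) / 2) + b * v 2) ∧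
    (∏ i ∈ S, G i).coeff 3 =
      (∏ i ∈ S, A (deg i)) * (a₃ * v 1 + a₁ * a₂ * (v 1 * (v 1 - 1)) +
        a₁ ^ 3 * (v 1 * (v 1 - 1) * (v 1 - 2) / 6) + a₁ * b * (v 1 * v 2) + c * v 3) := by
  classical
  induction S using Finset.induction_on generalizing v with
  | empty => simp [hv, coeff_one]
  | insert i S hi ih =>
    have hS : ∀ j ∈ S, j ∈ insert i S := fun j hj => Finset.mem_insert_of_mem hj
    obtain ⟨e₀, e₁, e₂, e₃⟩ := ih (fun j hj => hdeg j (hS j hj)) (fun j hj => h₀ j (hS j hj))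
      (fun j hj => h₁ j (hS j hj)) (fun j hj => h₂ j (hS j hj)) (fun j hj => h₃ j (hS j hj))
      (fun r => (S.filter fun i => deg i = r).card) fun r => rfl
    have hi' := Finset.mem_insert_self i S
    have hd := hdeg i hi'
    have hv' : ∀ r, v r = (S.filter fun i => deg i = r).card + if deg i = r then 1 else 0 := by
      intro r
      rw [hv, Finset.filter_insert]
      split_ifs with h
      · rw [Finset.card_insert_of_notMem (by simp [hi])]
        push_cast
        ring
      · simp
    rw [Finset.prod_insert hi, Finset.prod_insert hi]
    simp only [coeff_mul, Finset.Nat.antidiagonal_succ, Finset.Nat.antidiagonal_zero,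
      Finset.map_singleton, Finset.sum_cons, Finset.map_cons, Finset.sum_singleton,
      Function.Embedding.prodMap, Function.Embedding.coeFn_mk, Prod.map, Nat.succ_eq_add_one,
      Function.Embedding.refl_apply, zero_add, Nat.reduceAdd]
    rw [e₀, e₁, e₂, e₃, h₀ i hi', h₁ i hi', h₂ i hi', h₃ i hi', hv' 1, hv' 2, hv' 3]
    generalize ((S.filter fun i => deg i = 1).card : ℚ) = x
    generalize ((S.filter fun i => deg i = 2).card : ℚ) = y
    generalize ((S.filter fun i => deg i = 3).card : ℚ) = z
    by_cases d1 : deg i = 1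
    · simp only [d1, if_true]
      norm_num
      refine ⟨?_, ?_, ?_⟩ <;> ring
    by_cases d2 : deg i = 2
    · simp only [d2, if_true]
      norm_num
      refine ⟨?_, ?_, ?_⟩ <;> ring
    by_cases d3 : deg i = 3
    · simp only [d3, if_true]
      norm_num
      refine ⟨?_, ?_, ?_⟩ <;> ring
    simp only [d1, d2, d3, if_false]
    norm_num
    refine ⟨?_, ?_, ?_⟩ <;> ring

/-- The polynomial `∑_{j<e} (q^r - 1) q^{r(e-1-j)} X^{rj} + X^{re}`, by recursion on `e`. -/
noncomputable def primePowerPoly (q : ℚ) (r : ℕ) : ℕ → ℚ[X]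
  | 0 => 1
  | e + 1 => C ((q ^ r - 1) * (q ^ r) ^ e) + X ^ r * primePowerPoly q r e

theorem primePowerPoly_zero (q : ℚ) (r : ℕ) : primePowerPoly q r 0 = 1 := rfl

theorem gcdDegreePoly_irreducible_pow {F : Type*} [Field F] [Finite F] {P : F[X]} (hP : P.Monic)
    (hirr : Irreducible P) (e : ℕ) :
    gcdDegreePoly (P ^ e) = primePowerPoly (Nat.card F) P.natDegree e := by
  induction e with
  | zero => rw [pow_zero, gcdDegreePoly_one, primePowerPoly]
  | succ e ih => rw [gcdDegreePoly_irreducible_pow_succ hP hirr, ih, primePowerPoly]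

variable {q : ℚ} {r : ℕ}

theorem coeff_zero_primePowerPoly_succ (hr : 0 < r) (e : ℕ) :
    (primePowerPoly q r (e + 1)).coeff 0 = (q ^ r - 1) * (q ^ r) ^ e := by
  rw [primePowerPoly, coeff_add, coeff_C_zero, coeff_X_pow_mul', if_neg (by omega), add_zero]

theorem coeff_primePowerPoly_succ {k : ℕ} (hk : 0 < k) (e : ℕ) :
    (primePowerPoly q r (e + 1)).coeff k =
      if r ≤ k then (primePowerPoly q r e).coeff (k - r) else 0 := by
  rw [primePowerPoly, coeff_add, coeff_C_of_ne_zero hk.ne', coeff_X_pow_mul', zero_add]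

theorem coeff_one_primePowerPoly_succ (hr : 0 < r) (e : ℕ) :
    (primePowerPoly q r (e + 1)).coeff 1 =
      if r = 1 then (primePowerPoly q 1 e).coeff 0 else 0 := by
  rw [coeff_primePowerPoly_succ one_pos]
  by_cases h : r = 1
  · simp [h]
  · rw [if_neg h, if_neg (by omega)]

theorem coeff_two_primePowerPoly_succ (hr : 0 < r) (e : ℕ) :
    (primePowerPoly q r (e + 1)).coeff 2 =
      if r = 1 then (primePowerPoly q 1 e).coeff 1 else
        if r = 2 then (primePowerPoly q 2 e).coeff 0 else 0 := by
  rw [coeff_primePowerPoly_succ two_pos]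
  by_cases h : r = 1
  · simp [h]
  by_cases h' : r = 2
  · simp [h']
  · rw [if_neg h, if_neg h', if_neg (by omega)]

theorem coeff_three_primePowerPoly_succ (hr : 0 < r) (e : ℕ) :
    (primePowerPoly q r (e + 1)).coeff 3 =
      if r = 1 then (primePowerPoly q 1 e).coeff 2 else
        if r = 2 then (primePowerPoly q 2 e).coeff 1 else
          if r = 3 then (primePowerPoly q 3 e).coeff 0 else 0 := by
  rw [coeff_primePowerPoly_succ three_pos]
  by_cases h : r = 1
  · simp [h]
  by_cases h' : r = 2
  · simp [h']
  by_cases h'' : r = 3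
  · simp [h'']
  · rw [if_neg h, if_neg h', if_neg h'', if_neg (by omega)]

theorem coeff_three_prod_primePowerPoly {ι : Type*} (S : Finset ι) (deg : ι → ℕ)
    (hdeg : ∀ i ∈ S, 0 < deg i) (e : ℕ)
    (v : ℕ → ℚ) (hv : ∀ r, v r = (S.filter fun i => deg i = r).card)
    {a₁ a₂ a₃ b c : ℚ}
    (h₁ : (primePowerPoly q 1 e).coeff 0 = (q - 1) * q ^ e * a₁)
    (h₂ : (primePowerPoly q 1 e).coeff 1 = (q - 1) * q ^ e * a₂)
    (h₃ : (primePowerPoly q 1 e).coeff 2 = (q - 1) * q ^ e * a₃)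
    (hb : (primePowerPoly q 2 e).coeff 0 = (q ^ 2 - 1) * (q ^ 2) ^ e * b)
    (hc : (primePowerPoly q 3 e).coeff 0 = (q ^ 3 - 1) * (q ^ 3) ^ e * c) :
    (∏ i ∈ S, primePowerPoly q (deg i) (e + 1)).coeff 3 =
      (∏ i ∈ S, (q ^ deg i - 1) * (q ^ deg i) ^ e) *
        (a₃ * v 1 + a₁ * a₂ * (v 1 * (v 1 - 1)) +
        a₁ ^ 3 * (v 1 * (v 1 - 1) * (v 1 - 2) / 6) + a₁ * b * (v 1 * v 2) + c * v 3) := by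
  have hb' : (primePowerPoly q 2 e).coeff 1 = 0 := by
    cases e with
    | zero => simp [primePowerPoly, coeff_one]
    | succ e => simp [coeff_one_primePowerPoly_succ]
  refine (coeff_prod_of_coeff_eq S deg hdeg _ (fun r => (q ^ r - 1) * (q ^ r) ^ e) a₁ a₂ a₃ b c
    ?_ ?_ ?_ ?_ v hv).2.2.2
  · intro i hi
    rw [coeff_zero_primePowerPoly_succ (hdeg i hi)]
  · intro i hi
    rw [coeff_one_primePowerPoly_succ (hdeg i hi)]
    split_ifs with h
    · simp [h₁, h]
    · simp
  · intro i hi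
    rw [coeff_two_primePowerPoly_succ (hdeg i hi)]
    split_ifs with h h'
    · simp [h₂, h]
    · simp [hb, h']
    · simp
  · intro i hi
    rw [coeff_three_primePowerPoly_succ (hdeg i hi)]
    by_cases h : deg i = 1
    · simp [h₃, h]
    by_cases h' : deg i = 2
    · simp [hb', h']
    by_cases h'' : deg i = 3
    · simp [hc, h'']
    · simp [h, h', h'']

end coefficients

section factors

variable {F : Type*} [Field F]

/-- The finset of monic irreducible factors of `X ^ m - 1`. -/
noncomputable def irredFactors (F : Type*) [Field F] (m : ℕ) : Finset F[X] :=
  open Classical in (UniqueFactorizationMonoid.normalizedFactors (X ^ m - 1 : F[X])).toFinset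

theorem mem_irredFactors {m : ℕ} (hm : 0 < m) {P : F[X]} :
    P ∈ irredFactors F m ↔ Irreducible P ∧ P.Monic ∧ P ∣ X ^ m - 1 := by
  classical
  rw [irredFactors, Multiset.mem_toFinset]
  exact Polynomial.mem_normalizedFactors_iff (X_pow_sub_C_ne_zero hm 1)

theorem prod_irredFactors {m : ℕ} (hm : (m : F) ≠ 0) :
    ∏ P ∈ irredFactors F m, P = X ^ m - 1 := by
  classical
  have hm0 : m ≠ 0 := by rintro rfl; simp at hm
  have h0 : (X ^ m - 1 : F[X]) ≠ 0 := X_pow_sub_C_ne_zero (Nat.pos_of_ne_zero hm0) 1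
  have hsq : Squarefree (X ^ m - 1 : F[X]) := (X_pow_sub_one_separable_iff.2 hm).squarefree
  have hnd := (UniqueFactorizationMonoid.squarefree_iff_nodup_normalizedFactors h0).1 hsq
  refine eq_of_monic_of_associated (monic_prod_of_monic _ _ fun P hP =>
    ((mem_irredFactors (Nat.pos_of_ne_zero hm0)).1 hP).2.1)
    (monic_X_pow_sub_C 1 hm0) ?_
  have := UniqueFactorizationMonoid.prod_normalizedFactors h0
  rwa [← Multiset.toFinset_val (UniqueFactorizationMonoid.normalizedFactors _) |>.trans
    hnd.dedup, Finset.prod_val] at this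

theorem pairwise_isCoprime_irredFactors {m : ℕ} (hm : 0 < m) :
    (irredFactors F m : Set F[X]).Pairwise IsCoprime := by
  intro P hP Q hQ hPQ
  obtain ⟨hP, hPm, -⟩ := (mem_irredFactors hm).1 hP
  obtain ⟨hQ, hQm, -⟩ := (mem_irredFactors hm).1 hQ
  exact hP.coprime_iff_not_dvd.2 fun h => hPQ
    (eq_of_monic_of_associated hPm hQm ((hP.dvd_irreducible_iff_associated hQ).1 h))

theorem sum_natDegree_irredFactors {m : ℕ} (hm : (m : F) ≠ 0) :
    ∑ P ∈ irredFactors F m, P.natDegree = m := by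
  have hm0 : m ≠ 0 := by rintro rfl; simp at hm
  rw [← natDegree_prod_of_monic _ _ fun P hP =>
    ((mem_irredFactors (Nat.pos_of_ne_zero hm0)).1 hP).2.1, prod_irredFactors hm]
  exact natDegree_X_pow_sub_C

theorem X_pow_mul_sub_one {p : ℕ} [Fact p.Prime] [CharP F p] (s m : ℕ) :
    (X ^ (p ^ s * m) - 1 : F[X]) = (X ^ m - 1) ^ p ^ s := by
  rw [sub_pow_char_pow, one_pow, ← pow_mul, mul_comm]

theorem numIrredFactors_eq_card {p : ℕ} [Fact p.Prime] [CharP F p] (s : ℕ) {m : ℕ} (hm : 0 < m)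
    (r : ℕ) :
    numIrredFactors F (p ^ s * m) r =
      ((irredFactors F m).filter fun P => P.natDegree = r).card := by
  rw [numIrredFactors, ← Set.ncard_coe_finset]
  congr 1
  ext P
  have hps : p ^ s ≠ 0 := pow_ne_zero _ (Fact.out : p.Prime).ne_zero
  simp only [Set.mem_ofPred_eq, Finset.coe_filter, mem_irredFactors hm, X_pow_mul_sub_one]
  constructor
  · rintro ⟨h₁, h₂, h₃, h₄⟩
    exact ⟨⟨h₂, h₁, h₂.prime.dvd_of_dvd_pow h₃⟩, h₄⟩
  · rintro ⟨⟨h₁, h₂, h₃⟩, h₄⟩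
    exact ⟨h₂, h₁, h₃.trans (dvd_pow_self _ hps), h₄⟩

theorem natDegree_dvd_of_mem_irredFactors [Finite F] {m d : ℕ} (hm : 0 < m)
    (hd : Nat.card F ^ d ≡ 1 [MOD m]) {P : F[X]} (hP : P ∈ irredFactors F m) :
    P.natDegree ∣ d := by
  obtain ⟨hirr, -, hdvd⟩ := (mem_irredFactors hm).1 hP
  have hpos : 1 ≤ Nat.card F ^ d := Nat.one_le_pow _ _ Nat.card_pos
  obtain ⟨t, ht⟩ := (Nat.modEq_iff_dvd' hpos).1 hd.symm
  refine hirr.natDegree_dvd_of_dvd_X_pow_card_pow_sub_X (hdvd.trans ?_)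
  have : (X ^ Nat.card F ^ d - X : F[X]) = X * ((X ^ m) ^ t - 1) := by
    rw [← pow_mul, ← ht, mul_sub, mul_one, ← pow_succ', Nat.sub_add_cancel hpos]
  rw [this]
  exact (sub_one_dvd_pow_sub_one _ _).mul_left _

theorem prod_irredFactors_natDegree [Finite F] {m d : ℕ} (hm : 0 < m) (hd0 : 0 < d)
    (hd : Nat.card F ^ d ≡ 1 [MOD m]) (g : ℕ → ℚ) :
    ∏ P ∈ irredFactors F m, g P.natDegree =
      ∏ r ∈ d.divisors, g r ^ ((irredFactors F m).filter fun P => P.natDegree = r).card := by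
  rw [← Finset.prod_fiberwise_of_maps_to (t := d.divisors) (g := natDegree)
    fun P hP => Nat.mem_divisors.2 ⟨natDegree_dvd_of_mem_irredFactors hm hd hP, hd0.ne'⟩]
  refine Finset.prod_congr rfl fun r _ => Finset.prod_eq_pow_card fun P hP => ?_
  rw [(Finset.mem_filter.1 hP).2]

end factors

theorem numKNormal_three_eq (F K : Type*) [Field F] [Finite F] [Field K] [Finite K] [Algebra F K]
    (p s n₀ d e : ℕ) [Fact p.Prime] [CharP F p] (hn : Module.finrank F K = p ^ s * n₀)
    (hcop : Nat.Coprime n₀ p) (hd0 : 0 < d) (hd : Nat.card F ^ d ≡ 1 [MOD n₀])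
    (he : p ^ s = e + 1) {q a₁ a₂ a₃ b c : ℚ} (hq : (Nat.card F : ℚ) = q)
    (h₁ : (primePowerPoly q 1 e).coeff 0 = (q - 1) * q ^ e * a₁)
    (h₂ : (primePowerPoly q 1 e).coeff 1 = (q - 1) * q ^ e * a₂)
    (h₃ : (primePowerPoly q 1 e).coeff 2 = (q - 1) * q ^ e * a₃)
    (hb : (primePowerPoly q 2 e).coeff 0 = (q ^ 2 - 1) * (q ^ 2) ^ e * b)
    (hc : (primePowerPoly q 3 e).coeff 0 = (q ^ 3 - 1) * (q ^ 3) ^ e * c)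
    (v : ℕ → ℕ) (hv : ∀ r, v r = numIrredFactors F (p ^ s * n₀) r) :
    (numKNormal F K 3 : ℚ) =
      (a₃ * v 1 + a₁ * a₂ * (v 1 * (v 1 - 1)) + a₁ ^ 3 * (v 1 * (v 1 - 1) * (v 1 - 2) / 6) +
          a₁ * b * (v 1 * v 2) + c * v 3) * q ^ (n₀ * e) *
        ∏ r ∈ d.divisors, (q ^ r - 1) ^ v r := by
  have : FiniteDimensional F K := Module.Finite.of_finite
  have hn₀ : 0 < n₀ := Nat.pos_of_mul_pos_left (hn ▸ Module.finrank_pos (R := F) (M := K))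
  have hn₀' : (n₀ : F) ≠ 0 := by
    rw [Ne, CharP.cast_eq_zero_iff F p]
    exact (Nat.Prime.coprime_iff_not_dvd Fact.out).1 hcop.symm
  have hcard (r : ℕ) : v r = ((irredFactors F n₀).filter fun P => P.natDegree = r).card := by
    rw [hv, numIrredFactors_eq_card s hn₀]
  have hmem {P : F[X]} (hP : P ∈ irredFactors F n₀) := (mem_irredFactors hn₀).1 hP
  have hgen : gcdDegreePoly (X ^ Module.finrank F K - 1 : F[X]) =
      ∏ P ∈ irredFactors F n₀, primePowerPoly q P.natDegree (e + 1) := by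
    rw [hn, X_pow_mul_sub_one, ← prod_irredFactors hn₀', ← Finset.prod_pow, gcdDegreePoly_prod, he]
    · refine Finset.prod_congr rfl fun P hP => ?_
      rw [gcdDegreePoly_irreducible_pow (hmem hP).2.1 (hmem hP).1, hq]
    · exact fun P hP => (hmem hP).2.1.pow _
    · exact fun P hP Q hQ hPQ => (pairwise_isCoprime_irredFactors hn₀ hP hQ hPQ).pow
  have hprod : ∏ P ∈ irredFactors F n₀, (q ^ P.natDegree - 1) * (q ^ P.natDegree) ^ e =
      q ^ (n₀ * e) * ∏ r ∈ d.divisors, (q ^ r - 1) ^ v r := by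
    rw [Finset.prod_mul_distrib, Finset.prod_pow, Finset.prod_pow_eq_pow_sum,
      sum_natDegree_irredFactors hn₀',
      prod_irredFactors_natDegree hn₀ hd0 hd fun r => q ^ r - 1, ← pow_mul, mul_comm]
    simp only [hcard]
  rw [numKNormal_eq_coeff, hgen, coeff_three_prod_primePowerPoly _ _
    (fun P hP => (hmem hP).1.natDegree_pos) e (fun r => v r) (fun r => by rw [hcard])
    h₁ h₂ h₃ hb hc, hprod]
  ring

theorem mainTheorem5 (F K : Type*) [Field F] [Finite F] [Field K] [Finite K] [Algebra F K]
    (p q n s n₀ d : ℕ) [CharP F p] (hq : Nat.card F = q) (hn : Module.finrank F K = n)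
    (hfac : n = p ^ s * n₀) (hcop : Nat.Coprime n₀ p)
    (hd : IsLeast {m : ℕ | 0 < m ∧ q ^ m ≡ 1 [MOD n₀]} d)
    (v : ℕ → ℕ) (hv : ∀ r, v r = numIrredFactors F n r) :
    (3 < p ^ s →
      (numKNormal F K 3 : ℚ) =
        ((v 1 : ℚ) + 1 / 6 * (v 1 : ℚ) * ((v 1 : ℚ) - 1) * ((v 1 : ℚ) + 4)
            + (v 1 : ℚ) * (v 2 : ℚ) + (v 3 : ℚ))
          * (q : ℚ) ^ ((n : ℤ) - (n₀ : ℤ) - 3)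
          * ∏ r ∈ d.divisors, ((q : ℚ) ^ r - 1) ^ v r) ∧
    (p ^ s = 3 →
      (numKNormal F K 3 : ℚ) =
        ((q : ℚ) / ((q : ℚ) - 1) * (v 1 : ℚ)
            + 1 / 6 * (v 1 : ℚ) * ((v 1 : ℚ) - 1) * ((v 1 : ℚ) + 4)
            + (v 1 : ℚ) * (v 2 : ℚ) + (v 3 : ℚ))
          * (q : ℚ) ^ ((n : ℤ) - (n₀ : ℤ) - 3)
          * ∏ r ∈ d.divisors, ((q : ℚ) ^ r - 1) ^ v r) ∧
    (p ^ s = 2 →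
      (numKNormal F K 3 : ℚ) =
        (((q : ℚ) / ((q : ℚ) - 1) + ((v 1 : ℚ) - 2) / 6) * (v 1 : ℚ) * ((v 1 : ℚ) - 1)
            + (v 1 : ℚ) * (v 2 : ℚ) + (v 3 : ℚ))
          * (q : ℚ) ^ ((n : ℤ) - (n₀ : ℤ) - 3)
          * ∏ r ∈ d.divisors, ((q : ℚ) ^ r - 1) ^ v r) ∧
    (n = n₀ →
      (numKNormal F K 3 : ℚ) =
        ((v 1 : ℚ) * ((v 1 : ℚ) - 1) * ((v 1 : ℚ) - 2) / (6 * ((q : ℚ) - 1) ^ 3)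
            + (v 1 : ℚ) * (v 2 : ℚ) / (((q : ℚ) - 1) * ((q : ℚ) ^ 2 - 1))
            + (v 3 : ℚ) / ((q : ℚ) ^ 3 - 1))
          * ∏ r ∈ d.divisors, ((q : ℚ) ^ r - 1) ^ v r) := by
  have hp : Fact p.Prime := ⟨CharP.char_is_prime F p⟩
  have : FiniteDimensional F K := Module.Finite.of_finite
  have hn₀ : 0 < n₀ := by
    have h : 0 < Module.finrank F K := Module.finrank_pos
    rw [hn, hfac] at h
    exact Nat.pos_of_mul_pos_left h
  have hq1 : (1 : ℚ) < q := by
    rw [← hq]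
    exact_mod_cast Finite.one_lt_card
  have hq0 : (q : ℚ) ≠ 0 := by positivity
  have hd1 : (q : ℚ) - 1 ≠ 0 := (sub_pos.2 hq1).ne'
  have hd2 : (q : ℚ) ^ 2 - 1 ≠ 0 := (sub_pos.2 (one_lt_pow₀ hq1 two_ne_zero)).ne'
  have hd3 : (q : ℚ) ^ 3 - 1 ≠ 0 := (sub_pos.2 (one_lt_pow₀ hq1 three_ne_zero)).ne'
  have hz {e : ℕ} (he : p ^ s = e + 1) :
      (q : ℚ) ^ ((n : ℤ) - (n₀ : ℤ) - 3) = q ^ (n₀ * e) * ((q : ℚ)⁻¹) ^ 3 := by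
    have : (n : ℤ) - n₀ = ((n₀ * e : ℕ) : ℤ) := by
      rw [hfac, he]
      push_cast
      ring
    rw [this, zpow_sub₀ hq0, zpow_natCast, div_eq_mul_inv, inv_pow]
    rfl
  subst hfac
  have key := fun e he a₁ a₂ a₃ b c => numKNormal_three_eq F K p s n₀ d e hn hcop hd.1.1
    (hq ▸ hd.1.2) he (q := q) (a₁ := a₁) (a₂ := a₂) (a₃ := a₃) (b := b) (c := c) (by rw [hq])
  refine ⟨fun h => ?_, fun h => ?_, fun h => ?_, fun h => ?_⟩
  · obtain ⟨e, he⟩ : ∃ e, p ^ s = (e + 3) + 1 := ⟨p ^ s - 4, by omega⟩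
    rw [hz he, key _ he ((q : ℚ)⁻¹) ((q : ℚ)⁻¹ ^ 2) ((q : ℚ)⁻¹ ^ 3) ((q : ℚ)⁻¹ ^ 2) ((q : ℚ)⁻¹ ^ 3) ?_ ?_ ?_ ?_ ?_ v hv]
    · ring
    all_goals
      simp [coeff_zero_primePowerPoly_succ, coeff_one_primePowerPoly_succ,
        coeff_two_primePowerPoly_succ]
      field_simp
      ring
  · have he : p ^ s = 2 + 1 := h
    rw [hz he, key _ he ((q : ℚ)⁻¹) ((q : ℚ)⁻¹ ^ 2) ((q : ℚ)⁻¹ ^ 2 / ((q : ℚ) - 1)) ((q : ℚ)⁻¹ ^ 2) ((q : ℚ)⁻¹ ^ 3) ?_ ?_ ?_ ?_ ?_ v hv]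
    · field_simp
      ring
    all_goals
      simp [coeff_zero_primePowerPoly_succ, coeff_one_primePowerPoly_succ,
        coeff_two_primePowerPoly_succ, primePowerPoly_zero, coeff_one]
      try field_simp
  · have he : p ^ s = 1 + 1 := h
    rw [hz he, key _ he ((q : ℚ)⁻¹) ((q : ℚ)⁻¹ / ((q : ℚ) - 1)) 0 ((q : ℚ)⁻¹ ^ 2) ((q : ℚ)⁻¹ ^ 3) ?_ ?_ ?_ ?_ ?_ v hv]
    · field_simp
      ring
    all_goals
      simp [coeff_zero_primePowerPoly_succ, coeff_one_primePowerPoly_succ,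
        coeff_two_primePowerPoly_succ, primePowerPoly_zero, coeff_one]
      try field_simp
  · have he : p ^ s = 0 + 1 := Nat.eq_of_mul_eq_mul_right hn₀ (by omega)
    rw [key _ he (1 / ((q : ℚ) - 1)) 0 0 (1 / ((q : ℚ) ^ 2 - 1)) (1 / ((q : ℚ) ^ 3 - 1)) ?_ ?_ ?_ ?_ ?_ v hv]
    · field_simp
      ring
    all_goals
      simp [primePowerPoly_zero, coeff_one]
      try field_simp
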